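/- A field $K$ of characteristic $0$ is called Hilbertian if for every irreducible polynomial $g(T,X)\in K[T,X]$ of positive degree in $X$ there are infinitely many $a\in K$ such that $g(a,X)$ is irreducible in $K[X]$. Let $F$ be a field of characteristic $0$ and let $f\in F[x]$ be a polynomial of degree $d\ge 2$ such that all iterates $f^{\circ n}$, $n\ge 0$, are separable. The disjoint union $\bigsqcup_{n\ge 0}(f^{\circ n})^{-1}(0)$ of the sets of zeros of the iterates in $\overline F$, with an edge from $\alpha\in (f^{\circ (n+1)})^{-1}(0)$ to $\beta\in (f^{\circ n})^{-1}(0)$ whenever $f(\alpha)=\beta$, is a complete rooted $d$-ary tree $\mathrm T_\infty(d)$, and the action of $\mathrm{Gal}(\overline F/F)$ on it is a homomorphism $\rho_f:\mathrm{Gal}(\overline F/F)\to \operatorname{Aut}\mathrm T_\infty(d)$, the arboreal representation of $f$. **Theorem.** Let $k$ be a countable Hilbertian field of characteristic $0$. Then there is an algebraic extension $F/k$ such that 1. $F$ is Hilbertian; 2. the degree $[F:k]$, as a supernatural number (the least common multiple of the degrees of the finite subextensions of $F/k$), is a power of $2$, that is, no prime $p\neq 2$ divides it; 3. for every $f\in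 F[x]$ of degree $d\ge 2$ all of whose iterates are separable, the image of $\rho_f$ has infinite index in $\operatorname{Aut}\mathrm T_\infty(d)$. Consequently, Odoni's conjecture, that for every Hilbertian field $K$ of characteristic $0$ and every integer $d>1$ there is a polynomial $f\in K[x]$ of degree $d$, all of whose iterates are separable, such that $\rho_f$ is surjective, is false. -/

import Mathlib

open Polynomial

universe u v

/-- A field `K` of characteristic zero is Hilbertian if Hilbert's irreducibility theorem holds over
`K`: for every irreducible polynomial `f(T, X)` in two variables over `K` of positive degree in `X`
there are infinitely many `a ∈ K` such that `f(a, X)` is irreducible in `K[X]`.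
Here `f` is a polynomial in `X` whose coefficients are polynomials in `T`. -/
def IsHilbertian (K : Type u) [Field K] : Prop :=
  ∀ f : Polynomial (Polynomial K), Irreducible f → 1 ≤ f.natDegree →
    {a : K | Irreducible (f.map (evalRingHom a))}.Infinite

/-- The degree `[F : k] = ∏ p ^ (e p)` of an algebraic extension as a supernatural number: the least
common multiple of the degrees of its finite subextensions. The value at a prime `p` is the exponent
`e p ∈ {0, 1, 2, …, ∞}`. -/
noncomputable def supernaturalDegree (k : Type u) (F : Type v) [Field k] [Field F] [Algebra k F]
    (p : ℕ) : ℕ∞ :=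
  ⨆ (E : IntermediateField k F) (_ : FiniteDimensional k E),
    (padicValNat p (Module.finrank k E) : ℕ∞)

/-- The complete rooted `d`-ary tree: vertices are finite words in `d` letters, the root is the
empty word, and there is an edge from `v` to `w` if `w` is the parent of `v`, that is, `v` is
obtained from `w` by adding one letter in front. -/
def RegularTreeEdge (d : ℕ) (v w : List (Fin d)) : Prop :=
  ∃ i : Fin d, v = i :: w

/-- The automorphism group of the complete rooted `d`-ary tree. (An automorphism preserves the edges
directed towards the root; hence it fixes the root, the only vertex that has no outgoing edge.) -/
abbrev AutRegularTree (d : ℕ) : Type :=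
  RegularTreeEdge d ≃r RegularTreeEdge d

section Arboreal

variable {F : Type u} [Field F]

/-- `f` and all of its iterates `f ∘ f ∘ ⋯ ∘ f` are separable. -/
def SeparableIterates (f : F[X]) : Prop :=
  ∀ n : ℕ, (f.comp^[n] X).Separable

/-- The disjoint union over `n ≥ 0` of the sets `(f^n)⁻¹(0)` in the algebraic closure, where `f^n` is
the `n`-th iterate: pairs `(n, α)` with `f^n(α) = 0`. -/
abbrev PreimageVertex (f : F[X]) : Type u :=
  {v : ℕ × AlgebraicClosure F // (fun x => aeval x f)^[v.1] v.2 = 0}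

/-- The edges of the preimage tree: from `(n + 1, α)` to `(n, β)` whenever `f(α) = β`. -/
def PreimageEdge (f : F[X]) (v w : PreimageVertex f) : Prop :=
  v.1.1 = w.1.1 + 1 ∧ aeval v.1.2 f = w.1.2

theorem iterate_aeval_galois (f : F[X]) (g : Field.absoluteGaloisGroup F) (n : ℕ)
    (α : AlgebraicClosure F) :
    (fun x => aeval x f)^[n] (g.toFun α) = g.toFun ((fun x => aeval x f)^[n] α) := by
  have h : Function.Semiconj g.toFun (fun x => aeval x f) (fun x => aeval x f) := fun x =>
    (aeval_algHom_apply (AlgEquiv.toAlgHom g) x f).symm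
  exact (h.iterate_right n α).symm

/-- An element `g` of the absolute Galois group acts on vertices by `(n, α) ↦ (n, g α)`. -/
def galoisVertex (f : F[X]) (g : Field.absoluteGaloisGroup F) (v : PreimageVertex f) :
    PreimageVertex f :=
  ⟨(v.1.1, g.toFun v.1.2), by
    have h := iterate_aeval_galois f g v.1.1 v.1.2
    rw [v.2] at h
    exact h.trans (map_zero (AlgEquiv.toAlgHom g))⟩

theorem galoisVertex_mul (f : F[X]) (g h : Field.absoluteGaloisGroup F) (v : PreimageVertex f) :
    galoisVertex f (g * h) v = galoisVertex f g (galoisVertex f h v) := rfl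

theorem galoisVertex_one (f : F[X]) (v : PreimageVertex f) : galoisVertex f 1 v = v := rfl

theorem galoisVertex_edge (f : F[X]) (g : Field.absoluteGaloisGroup F) (v w : PreimageVertex f)
    (h : PreimageEdge f v w) : PreimageEdge f (galoisVertex f g v) (galoisVertex f g w) :=
  ⟨h.1, (iterate_aeval_galois f g 1 v.1.2).trans (congrArg g.toFun h.2)⟩

/-- The action of the absolute Galois group on the preimage tree. -/
noncomputable def galoisPreimageTree (f : F[X]) :
    Field.absoluteGaloisGroup F →* (PreimageEdge f ≃r PreimageEdge f) where
  toFun g :=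
    { toFun := galoisVertex f g
      invFun := galoisVertex f g⁻¹
      left_inv := fun v => by rw [← galoisVertex_mul, inv_mul_cancel, galoisVertex_one]
      right_inv := fun v => by rw [← galoisVertex_mul, mul_inv_cancel, galoisVertex_one]
      map_rel_iff' := by
        intro v w
        refine ⟨fun h => ?_, galoisVertex_edge f g v w⟩
        have h' := galoisVertex_edge f g⁻¹ _ _ h
        simpa only [Equiv.coe_fn_mk, ← galoisVertex_mul, inv_mul_cancel, galoisVertex_one] using h' }
  map_one' := rfl
  map_mul' _ _ := rfl

theorem iterate_comp_X_succ (f : F[X]) (n : ℕ) :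
    f.comp^[n + 1] X = (f.comp^[n] X).comp f := by
  induction n with
  | zero => simp
  | succ n ih => rw [Function.iterate_succ_apply', ih, ← comp_assoc, ← Function.iterate_succ_apply' f.comp, ih]

theorem aeval_iterate_comp_X (f : F[X]) (n : ℕ) (α : AlgebraicClosure F) :
    aeval α (f.comp^[n] X) = (fun x => aeval x f)^[n] α := by
  induction n with
  | zero => simp
  | succ n ih => rw [Function.iterate_succ_apply', aeval_comp, ih, Function.iterate_succ_apply']

/-- Every vertex of the preimage tree has exactly `deg f` children. -/
theorem nonempty_equiv_children (f : F[X]) (hf : SeparableIterates f) (v : PreimageVertex f) :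
    Nonempty (Fin f.natDegree ≃ {α : AlgebraicClosure F // aeval α f = v.1.2}) := by
  classical
  set φ := algebraMap F (AlgebraicClosure F)
  set q : (AlgebraicClosure F)[X] := f.map φ - C v.1.2 with hq
  have hdvd : q ∣ (f.comp^[v.1.1 + 1] X).map φ := by
    have h0 : (X - C v.1.2) ∣ (f.comp^[v.1.1] X).map φ := by
      rw [dvd_iff_isRoot, IsRoot.def, eval_map_algebraMap, aeval_iterate_comp_X]
      exact v.2
    obtain ⟨r, hr⟩ := h0
    refine ⟨r.comp (f.map φ), ?_⟩
    rw [iterate_comp_X_succ, Polynomial.map_comp, hr]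
    simp [hq]
  have hsep : q.Separable := ((hf (v.1.1 + 1)).map (f := φ)).of_dvd hdvd
  have hcard : q.roots.toFinset.card = f.natDegree := by
    rw [Multiset.toFinset_card_of_nodup (nodup_roots hsep),
      ← (IsAlgClosed.splits q).natDegree_eq_card_roots, hq, natDegree_sub_C, natDegree_map]
  have hmem : ∀ α, α ∈ q.roots.toFinset ↔ aeval α f = v.1.2 := by
    intro α
    rw [Multiset.mem_toFinset, mem_roots hsep.ne_zero, IsRoot.def, hq, eval_sub, eval_C,
      eval_map_algebraMap, sub_eq_zero]
  exact ⟨(Finset.equivFinOfCardEq hcard).symm.trans (Equiv.subtypeEquivRight hmem)⟩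

/-- The preimage tree is a complete rooted `deg f`-ary tree. -/
theorem nonempty_preimageTree_iso (f : F[X]) (hf : SeparableIterates f) :
    Nonempty (PreimageEdge f ≃r RegularTreeEdge f.natDegree) := by
  have c := fun v => (nonempty_equiv_children f hf v).some
  let child : Fin f.natDegree → PreimageVertex f → PreimageVertex f := fun i v =>
    ⟨(v.1.1 + 1, (c v i).1), by
      change (fun x => aeval x f)^[v.1.1] (aeval (c v i).1 f) = 0
      rw [(c v i).2]; exact v.2⟩
  let φ : List (Fin f.natDegree) → PreimageVertex f := fun l =>
    l.rec ⟨(0, 0), rfl⟩ (fun i _ v => child i v)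
  have hedge : ∀ i v, PreimageEdge f (child i v) v := fun i v => ⟨rfl, (c v i).2⟩
  have huniq : ∀ v w w', PreimageEdge f v w → PreimageEdge f v w' → w = w' := by
    rintro v ⟨⟨a, b⟩, h⟩ ⟨⟨a', b'⟩, h'⟩ ⟨h1, h2⟩ ⟨h3, h4⟩
    apply Subtype.ext
    apply Prod.ext
    · simp only at h1 h3 ⊢; omega
    · exact h2.symm.trans h4
  have hchild : ∀ v w, PreimageEdge f v w → ∃ i, v = child i w := by
    intro v w h
    refine ⟨(c w).symm ⟨v.1.2, h.2⟩, Subtype.ext (Prod.ext h.1 ?_)⟩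
    simp [child]
  have hchild_inj : ∀ v i j, child i v = child j v → i = j := by
    intro v i j h
    apply (c v).injective
    apply Subtype.ext
    exact congrArg (fun w : PreimageVertex f => w.1.2) h
  have hinj : Function.Injective φ := by
    intro l
    induction l with
    | nil =>
      intro l' h
      cases l' with
      | nil => rfl
      | cons j m =>
        have h0 : 0 = (φ m).1.1 + 1 := congrArg (fun w : PreimageVertex f => w.1.1) h
        omega
    | cons i l ih =>
      intro l' h
      cases l' with
      | nil =>
        have h0 : (φ l).1.1 + 1 = 0 := congrArg (fun w : PreimageVertex f => w.1.1) h
        omega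
      | cons j m =>
        have h' : child i (φ l) = child j (φ m) := h
        have e : φ l = φ m := huniq _ _ _ (hedge i (φ l)) (h' ▸ hedge j (φ m))
        obtain rfl := ih e
        rw [hchild_inj _ _ _ h']
  have hsurj : ∀ n (v : PreimageVertex f), v.1.1 = n → ∃ l, φ l = v := by
    intro n
    induction n with
    | zero =>
      rintro ⟨⟨a, b⟩, h⟩ (rfl : a = 0)
      exact ⟨[], Subtype.ext (Prod.ext rfl (Eq.symm h))⟩
    | succ n ih =>
      rintro ⟨⟨a, b⟩, h⟩ (rfl : a = n + 1)
      obtain ⟨l, hl⟩ := ih ⟨(n, aeval b f), h⟩ rfl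
      obtain ⟨i, hi⟩ := hchild ⟨(n + 1, b), h⟩ (φ l) (by rw [hl]; exact ⟨rfl, rfl⟩)
      exact ⟨i :: l, hi.symm⟩
  refine ⟨RelIso.symm ⟨Equiv.ofBijective φ ⟨hinj, fun v => hsurj _ v rfl⟩, ?_⟩⟩
  intro l m
  change PreimageEdge f (φ l) (φ m) ↔ _
  constructor
  · intro h
    obtain ⟨i, hi⟩ := hchild _ _ h
    exact ⟨i, hinj hi⟩
  · rintro ⟨i, rfl⟩
    exact hedge i (φ m)

/-- The arboreal representation attached to `f`: the action of the absolute Galois group on the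
preimage tree, which is identified with the complete rooted `deg f`-ary tree. (Another identification
changes the representation by an inner automorphism of the target.) -/
noncomputable def arborealRep (f : F[X]) (hf : SeparableIterates f) :
    Field.absoluteGaloisGroup F →* AutRegularTree f.natDegree :=
  let e := (nonempty_preimageTree_iso f hf).some
  { toFun := fun g => (e.symm.trans (galoisPreimageTree f g)).trans e
    map_one' := by ext v; simp
    map_mul' := fun g h => by ext v; simp }

end Arboreal

/-- Odoni's conjecture (for fields in the universe `u`): over every Hilbertian field of
characteristic zero and for every `d > 1` there is a polynomial of degree `d` whose arboreal
representation is surjective. -/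
def OdoniConjecture : Prop :=
  ∀ (K : Type u) [Field K] [CharZero K], IsHilbertian K → ∀ d : ℕ, 1 < d →
    ∃ (f : K[X]) (hf : SeparableIterates f),
      f.natDegree = d ∧ Function.Surjective (arborealRep f hf)

/-! `F` is the union of a generic chain of finite extensions of `k`, each step trivial or built from
quadratic extensions, so only the prime 2 enters the degree. A stage also carries finitely many
polynomials, irreducible over its field, which every later stage must keep irreducible
(`ApproxField`). Since `k` is countable there are countably many tasks, and `exists_generic_chain`
meets them all.

Infinite index: Galois acts on a square root of the discriminant of the `n`-th iterate through the
sign of its action on level `n`. If for arbitrarily large `n` this discriminant, or its product with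
an earlier one, is a square, the image satisfies infinitely many relations between level signs. They
are independent, because a tree automorphism can be odd on level `n` and trivial on all lower levels
(`AutRegularTree.not_finiteIndex_of_levelSign`).

Such squares can be created without breaking promises. Adjoining `√c` to `E` can make an irreducible
`q` reducible only if `√c` lies in the root field `E(θ)`. If this happened for all late
discriminants, infinitely many square roots would lie in one finite extension of `E`, which has
finitely many subfields; two of them would generate the same field, and the product of their
discriminants would already be a square (`isSquare_or_exists_irreducible_map_adjoin_sqrt`).

Hilbertianity: a norm argument carries it to quadratic extensions
(`IsHilbertian.of_isQuadraticExtension`), so every stage has it. A good specialization found at one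
stage is promised to stay irreducible, and therefore is irreducible over `F`. -/

/-! ### Norms and Hilbertianity of quadratic extensions -/

/-- `i` identifies `R` with the fixed ring of the involution `τ` of `S`. -/
structure IsFixedRingOfInvolution {R S : Type*} [CommRing R] [CommRing S]
    (i : R →+* S) (τ : S →+* S) : Prop where
  injective : Function.Injective i
  involutive : ∀ x, τ (τ x) = x
  map_apply : ∀ r, τ (i r) = i r
  exists_of_fixed : ∀ x, τ x = x → ∃ r, i r = x

namespace IsFixedRingOfInvolution

variable {R S : Type*} [CommRing R] [CommRing S] {i : R →+* S} {τ : S →+* S}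

/-- Fixedness is tested on coefficients. Applied twice, this passes from a quadratic extension `L/K`
to the rings of polynomials in two variables. -/
theorem polynomial (h : IsFixedRingOfInvolution i τ) :
    IsFixedRingOfInvolution (mapRingHom i) (mapRingHom τ) where
  injective := map_injective _ h.injective
  involutive p := by ext n; simp [h.involutive]
  map_apply p := by ext n; simp [h.map_apply]
  exists_of_fixed p hp := by
    have : p ∈ lifts i := by
      rw [lifts_iff_coeff_lifts]
      intro n
      refine h.exists_of_fixed _ ?_
      conv_rhs => rw [← hp]
      simp
    exact (mem_lifts p).1 this

theorem exists_norm (h : IsFixedRingOfInvolution i τ) (x : S) : ∃ r, i r = x * τ x :=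
  h.exists_of_fixed _ (by rw [map_mul, h.involutive, mul_comm])

theorem isUnit_of_map (h : IsFixedRingOfInvolution i τ) {r : R} (hr : IsUnit (i r)) :
    IsUnit r := by
  obtain ⟨s, hs⟩ := isUnit_iff_exists_inv.1 hr
  have hs' : i r * τ s = 1 := by rw [← h.map_apply r, ← map_mul, hs, map_one]
  have hτ : τ s = s := by
    calc τ s = τ s * (i r * s) := by rw [hs, mul_one]
      _ = (i r * τ s) * s := by ring
      _ = s := by rw [hs', one_mul]
  obtain ⟨t, rfl⟩ := h.exists_of_fixed s hτ
  refine isUnit_iff_exists_inv.2 ⟨t, h.injective ?_⟩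
  rw [map_mul, hs, map_one]

/-- A factor of `n` is fixed by `τ`, so if the prime `x` divides it, then so does `τ x`. As `x` does
not divide `τ x`, the product `x * τ x` divides this factor, and the cofactor is a unit. -/
theorem irreducible_norm [IsDomain S] (h : IsFixedRingOfInvolution i τ) {x : S} {n : R}
    (hn : i n = x * τ x) (hx : Prime x) (hxτ : ¬ x ∣ τ x) : Irreducible n := by
  have key : ∀ a b : R, n = a * b → x ∣ i a → IsUnit b := by
    rintro a b rfl ⟨c, hc⟩
    have h1 : x ∣ τ x * τ c := ⟨c, by rw [← hc, ← map_mul, ← hc, h.map_apply]⟩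
    obtain ⟨e, he⟩ := (hx.dvd_or_dvd h1).resolve_left hxτ
    have hce : c = τ x * τ e := by rw [← map_mul, ← he, h.involutive]
    refine h.isUnit_of_map (isUnit_iff_exists_inv.2 ⟨τ e, ?_⟩)
    have h0 : x * τ x ≠ 0 := by
      refine mul_ne_zero hx.ne_zero fun h0 => hxτ (h0 ▸ dvd_zero x)
    apply mul_left_cancel₀ h0
    rw [map_mul, hc, hce] at hn
    calc x * τ x * (i b * τ e) = x * (τ x * τ e) * i b := by ring
      _ = x * τ x * 1 := by rw [hn, mul_one]
  refine ⟨fun hu => hx.not_isUnit ?_, fun a b hab => ?_⟩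
  · exact isUnit_of_mul_isUnit_left (hn ▸ hu.map i)
  · have hdvd : x ∣ i a * i b := ⟨τ x, by rw [← map_mul, ← hab, hn]⟩
    rcases hx.dvd_or_dvd hdvd with h1 | h1
    · exact Or.inr (key a b hab h1)
    · exact Or.inl (key b a (hab.trans (mul_comm a b)) h1)

/-- The norm is multiplicative, and an element with unit norm is a unit. -/
theorem irreducible_of_norm (h : IsFixedRingOfInvolution i τ) {x : S} {n : R}
    (hn : i n = x * τ x) (hirr : Irreducible n) : Irreducible x := by
  refine ⟨fun hu => hirr.not_isUnit (h.isUnit_of_map ?_), ?_⟩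
  · rw [hn]; exact hu.mul (hu.map τ)
  · rintro a b rfl
    obtain ⟨r, hr⟩ := h.exists_norm a
    obtain ⟨s, hs⟩ := h.exists_norm b
    have : n = r * s := h.injective (by rw [hn, map_mul, map_mul, hr, hs]; ring)
    rcases hirr.isUnit_or_isUnit this with hu | hu
    · exact Or.inl (isUnit_of_mul_isUnit_left (hr ▸ hu.map i))
    · exact Or.inr (isUnit_of_mul_isUnit_left (hs ▸ hu.map i))

end IsFixedRingOfInvolution

/-- Over a domain of characteristic zero, a polynomial of positive degree does not divide a proper
translate of itself. -/
theorem Polynomial.not_dvd_taylor {R : Type*} [CommRing R] [IsDomain R] [CharZero R] {r : R}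
    (hr : r ≠ 0) {f : R[X]} (hf : 1 ≤ f.natDegree) : ¬ f ∣ taylor r f := by
  rintro ⟨g, hg⟩
  have hf0 : f ≠ 0 := by rintro rfl; simp at hf
  have hg0 : g ≠ 0 := by
    rintro rfl
    rw [mul_zero] at hg
    exact hf0 (taylor_injective r (hg.trans (map_zero _).symm))
  have hdeg := congrArg natDegree hg
  rw [natDegree_taylor, natDegree_mul hf0 hg0] at hdeg
  obtain ⟨c, rfl⟩ := natDegree_eq_zero.1 (show g.natDegree = 0 by omega)
  have hlc := congrArg leadingCoeff hg
  rw [leadingCoeff_mul, leadingCoeff_C, leadingCoeff_taylor] at hlc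
  have hc : c = 1 := mul_left_cancel₀ (leadingCoeff_ne_zero.2 hf0) (by rw [← hlc, mul_one])
  subst hc
  rw [C_1, mul_one] at hg
  -- The quotient is 1, so `f` has period `r`. Its value at 0 recurs at all multiples of `r`, which
  -- are infinitely many in characteristic zero.
  have heval : ∀ n : ℕ, f.eval (n * r) = f.eval 0 := by
    intro n
    induction n with
    | zero => simp
    | succ n ih => rw [Nat.cast_succ, add_mul, one_mul, ← taylor_eval, hg, ih]
  have hconst : f = C (f.eval 0) := by
    refine eq_of_infinite_eval_eq _ _ (Set.infinite_of_injective_forall_mem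
      (f := fun n : ℕ => (n : R) * r) (fun m n hmn => ?_) fun n => ?_)
    · exact_mod_cast mul_right_cancel₀ hr hmn
    · simp [heval]
  rw [hconst, natDegree_C] at hf
  omega

theorem Polynomial.taylor_dvd {R : Type*} [CommRing R] (r : R) {p q : R[X]} (h : p ∣ q) :
    taylor r p ∣ taylor r q := by
  obtain ⟨c, rfl⟩ := h
  exact ⟨taylor r c, taylor_mul ..⟩

/-- Some translate of `f` in its second variable does not divide its own conjugate. -/
theorem IsFixedRingOfInvolution.exists_not_dvd_conj_taylor {K L : Type*} [Field K] [Field L]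
    [CharZero L] {i : K →+* L} {σ : L →+* L} (h : IsFixedRingOfInvolution i σ) {δ : L}
    (hδ : σ δ = -δ) (hδ0 : δ ≠ 0) {f : L[X][X]} (hdeg : 1 ≤ f.natDegree) :
    ∃ c : L, ¬ taylor (C c) f ∣ (taylor (C c) f).map (mapRingHom σ) := by
  by_contra! H
  -- Translation by 0 gives `f ∣ σf`, hence `σf ∣ f`. Translation by `δ` gives `f(X + δ) ∣ (σf)(X -
  -- δ) ∣ f(X - δ)`, that is, `f ∣ f(X - 2δ)`, which is impossible.
  have H0 := H 0
  rw [C_0, taylor_zero] at H0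
  have H1 := H δ
  have H2 : f.map (mapRingHom σ) ∣ f := by
    have := map_dvd (mapRingHom (mapRingHom σ)) H0
    rwa [coe_mapRingHom, ← coe_mapRingHom (mapRingHom σ),
      h.polynomial.polynomial.involutive f] at this
  rw [map_taylor, coe_mapRingHom, map_C, hδ] at H1
  have H3 := taylor_dvd (-C δ)
    (H1.trans (taylor_dvd (C (-δ)) H2))
  simp only [taylor_taylor, neg_add_cancel, taylor_zero] at H3
  refine not_dvd_taylor ?_ hdeg H3
  rw [C_neg, ← neg_add, ← C_add, neg_ne_zero, Ne, C_eq_zero, ← two_mul]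
  exact mul_ne_zero two_ne_zero hδ0

/-- If the fixed field of a nontrivial involution of `L` is Hilbertian, then so is `L`. -/
theorem IsHilbertian.of_involution {K L : Type*} [Field K] [Field L] [CharZero L]
    (hK : IsHilbertian K) {i : K →+* L} {σ : L →+* L} (h : IsFixedRingOfInvolution i σ) {δ : L}
    (hδ : σ δ = -δ) (hδ0 : δ ≠ 0) : IsHilbertian L := by
  intro f hf hdeg
  suffices H : ∃ c : L, ¬ taylor (C c) f ∣ (taylor (C c) f).map (mapRingHom σ) by
    obtain ⟨c, hc⟩ := H
    set g := taylor (C c) f with hg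
    have hgirr : Irreducible g := (MulEquiv.irreducible_iff (taylorEquiv (C c))).2 hf
    obtain ⟨n, hn⟩ := h.polynomial.polynomial.exists_norm g
    have hnirr := h.polynomial.polynomial.irreducible_norm hn hgirr.prime hc
    have hndeg : 1 ≤ n.natDegree := by
      have h1 := congrArg natDegree hn
      rw [coe_mapRingHom, coe_mapRingHom, natDegree_map_eq_of_injective h.polynomial.injective,
        natDegree_mul hgirr.ne_zero, hg, natDegree_taylor] at h1
      · omega
      · intro h0
        exact hc (h0 ▸ dvd_zero _)
    refine ((hK n hnirr hndeg).image (h.injective.injOn)).mono ?_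
    rintro _ ⟨a, ha, rfl⟩
    -- Specialization at a point of `K` commutes with `σ`, so the norm relation survives it.
    have h2 : mapRingHom i (n.map (evalRingHom a)) =
        g.map (evalRingHom (i a)) * mapRingHom σ (g.map (evalRingHom (i a))) := by
      have h3 := congrArg (map (evalRingHom (i a))) hn
      rw [Polynomial.map_mul] at h3
      convert h3 using 2
      · simp only [coe_mapRingHom, Polynomial.map_map]
        congr 1
        ext <;> simp
      · simp only [coe_mapRingHom, Polynomial.map_map]
        congr 1
        ext <;> simp [h.map_apply]
    have h4 := h.polynomial.irreducible_of_norm h2 ha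
    have h5 : g.map (evalRingHom (i a)) = taylor c (f.map (evalRingHom (i a))) := by
      rw [hg, map_taylor]; simp
    rw [h5] at h4
    exact (MulEquiv.irreducible_iff (taylorEquiv c)).1 h4
  exact h.exists_not_dvd_conj_taylor hδ hδ0 hdeg

/-- A quadratic extension of a Hilbertian field of characteristic zero is Hilbertian. -/
theorem IsHilbertian.of_isQuadraticExtension {K L : Type*} [Field K] [Field L] [CharZero K]
    [Algebra K L] [Algebra.IsQuadraticExtension K L] (hK : IsHilbertian K) : IsHilbertian L := by
  have : CharZero L := charZero_of_injective_algebraMap (algebraMap K L).injective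
  have hcard : Nat.card Gal(L/K) = 2 := by
    rw [IsGalois.card_aut_eq_finrank, Algebra.IsQuadraticExtension.finrank_eq_two]
  obtain ⟨σ, hσ, huniq⟩ := (Nat.card_eq_two_iff' (1 : Gal(L/K))).1 hcard
  have hall : ∀ τ : Gal(L/K), τ = 1 ∨ τ = σ := fun τ => or_iff_not_imp_left.2 (huniq τ)
  have hinv : ∀ x, σ (σ x) = x := by
    intro x
    rcases hall (σ * σ) with h | h
    · exact DFunLike.congr_fun h x
    · exact absurd (mul_eq_left.1 h) hσ
  have h : IsFixedRingOfInvolution (algebraMap K L) (σ : L →+* L) :=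
    { injective := (algebraMap K L).injective
      involutive := hinv
      map_apply := fun r => σ.commutes r
      exists_of_fixed := fun x hx => by
        refine (IsGalois.mem_range_algebraMap_iff_fixed x).2 fun τ => ?_
        rcases hall τ with rfl | rfl
        · rfl
        · exact hx }
  obtain ⟨x, hx⟩ : ∃ x, σ x ≠ x := by
    by_contra! hfix
    exact hσ (AlgEquiv.ext hfix)
  refine hK.of_involution h (δ := σ x - x) ?_ (sub_ne_zero.2 hx)
  change σ (σ x - x) = _
  rw [map_sub, hinv, neg_sub]

/-! ### Adjoining square roots without breaking irreducibility -/

open IntermediateField in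
/-- Every element of `E(s)` with `s ^ 2 ∈ E` has the form `a + b * s`. -/
theorem exists_eq_add_mul_of_mem_adjoin_sqrt {E Ω : Type*} [Field E] [Field Ω] [Algebra E Ω]
    {s : Ω} {c : E} (hs : s ^ 2 = algebraMap E Ω c) {x : Ω} (hx : x ∈ E⟮s⟯) :
    ∃ a b : E, x = algebraMap E Ω a + algebraMap E Ω b * s := by
  have hint : IsIntegral E s := IsIntegral.of_pow two_pos (hs ▸ isIntegral_algebraMap)
  rw [← mem_toSubalgebra, adjoin_simple_toSubalgebra_of_isAlgebraic hint.isAlgebraic] at hx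
  induction hx using Algebra.adjoin_induction with
  | mem x hx =>
    rw [Set.mem_singleton_iff] at hx
    exact ⟨0, 1, by simp [hx]⟩
  | algebraMap r => exact ⟨r, 0, by simp⟩
  | add x y _ _ hx hy =>
    obtain ⟨a, b, rfl⟩ := hx
    obtain ⟨a', b', rfl⟩ := hy
    exact ⟨a + a', b + b', by simp only [map_add]; ring⟩
  | mul x y _ _ hx hy =>
    obtain ⟨a, b, rfl⟩ := hx
    obtain ⟨a', b', rfl⟩ := hy
    refine ⟨a * a' + b * b' * c, a * b' + b * a', ?_⟩
    simp only [map_add, map_mul, ← hs]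
    ring

open IntermediateField in
theorem finrank_adjoin_sqrt {E Ω : Type*} [Field E] [Field Ω] [Algebra E Ω]
    {s : Ω} {c : E} (hs : s ^ 2 = algebraMap E Ω c) (hsE : s ∉ (algebraMap E Ω).range) :
    Module.finrank E E⟮s⟯ = 2 := by
  have hint : IsIntegral E s := IsIntegral.of_pow two_pos (hs ▸ isIntegral_algebraMap)
  rw [adjoin.finrank hint]
  refine le_antisymm ?_ ((minpoly.two_le_natDegree_iff hint).2 hsE)
  have hdvd : minpoly E s ∣ X ^ 2 - C c := minpoly.dvd _ _ (by simp [hs])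
  exact (natDegree_le_of_dvd hdvd (X_pow_sub_C_ne_zero two_pos c)).trans
    (natDegree_X_pow_sub_C).le

open IntermediateField in
/-- An irreducible polynomial remains irreducible over a quadratic extension that is not contained
in the extension generated by one of its roots. -/
theorem Irreducible.map_adjoin_sqrt {E Ω : Type*} [Field E] [Field Ω] [Algebra E Ω]
    {q : E[X]} (hq : Irreducible q) {θ : Ω} (hθ : aeval θ q = 0)
    {s : Ω} {c : E} (hs : s ^ 2 = algebraMap E Ω c) (hsθ : s ∉ E⟮θ⟯) :
    Irreducible (q.map (algebraMap E E⟮s⟯)) := by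
  have hdvd : ∀ p : E[X], aeval θ p = 0 → q ∣ p := by
    intro p hp
    have h1 : minpoly E θ ∣ p := minpoly.dvd _ _ hp
    rw [← minpoly.eq_of_irreducible hq hθ] at h1
    exact (dvd_mul_right _ _).trans h1
  have hdecomp : ∀ w : E⟮s⟯[X], ∃ u v : E[X],
      w = u.map (algebraMap E E⟮s⟯) + C (AdjoinSimple.gen E s) * v.map (algebraMap E E⟮s⟯) := by
    intro w
    induction w using Polynomial.induction_on' with
    | add p q hp hq =>
      obtain ⟨u, v, rfl⟩ := hp
      obtain ⟨u', v', rfl⟩ := hq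
      exact ⟨u + u', v + v', by simp only [Polynomial.map_add]; ring⟩
    | monomial n x =>
      obtain ⟨a, b, hab⟩ := exists_eq_add_mul_of_mem_adjoin_sqrt hs x.2
      refine ⟨monomial n a, monomial n b, ?_⟩
      rw [map_monomial, map_monomial, C_mul_monomial, ← map_add]
      congr 1
      apply Subtype.ext
      rw [hab, mul_comm]
      rfl
  have hθint : IsIntegral E θ := IsAlgebraic.isIntegral ⟨q, hq.ne_zero, hθ⟩
  have hθint' : IsIntegral E⟮s⟯ θ := hθint.tower_top
  have hirr := minpoly.irreducible hθint'
  have hmap : ∀ p : E[X], aeval θ (p.map (algebraMap E E⟮s⟯)) = aeval θ p := fun p =>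
    aeval_map_algebraMap _ _ _
  -- Write the minimal polynomial of `θ` over `E(s)` as `u + s v`. Unless `v(θ) = 0`, evaluation at
  -- `θ` puts `s` into `E(θ)`; so both `u` and `v` vanish at `θ` and are divisible by `q`.
  have hqdvd : q.map (algebraMap E E⟮s⟯) ∣ minpoly E⟮s⟯ θ := by
    obtain ⟨u, v, huv⟩ := hdecomp (minpoly E⟮s⟯ θ)
    have h0 : aeval θ u + s * aeval θ v = 0 := by
      have := minpoly.aeval E⟮s⟯ θ
      rw [huv, map_add, map_mul, hmap, hmap, aeval_C] at this
      exact this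
    have hmem : ∀ p : E[X], aeval θ p ∈ E⟮θ⟯ := fun p => by
      have := (aeval (AdjoinSimple.gen E θ) p).2
      rwa [← coe_val, ← aeval_algHom_apply] at this
    have hv : aeval θ v = 0 := by
      by_contra hv
      apply hsθ
      have : s = -(aeval θ u) / aeval θ v := by
        rw [eq_div_iff hv]
        linear_combination h0
      rw [this]
      exact div_mem (neg_mem (hmem u)) (hmem v)
    have hu : aeval θ u = 0 := by rwa [hv, mul_zero, add_zero] at h0
    rw [huv]
    exact dvd_add (Polynomial.map_dvd _ (hdvd u hu))
      ((Polynomial.map_dvd _ (hdvd v hv)).mul_left _)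
  refine (((hirr.dvd_iff.1 hqdvd).resolve_left fun hu => hq.not_isUnit ?_)).irreducible_iff.1 hirr
  exact (isUnit_map _).1 hu

open IntermediateField in
/-- Two elements of `E` whose square roots generate the same quadratic extension of `E`
differ by a square factor. -/
theorem isSquare_mul_of_adjoin_sqrt_eq {E Ω : Type*} [Field E] [CharZero E] [Field Ω]
    [Algebra E Ω] {s t : Ω} {c d : E} (hs : s ^ 2 = algebraMap E Ω c)
    (ht : t ^ 2 = algebraMap E Ω d) (hc : ¬ IsSquare c) (hd : ¬ IsSquare d)
    (hst : s ∈ E⟮t⟯) : IsSquare (c * d) := by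
  have hnot : ∀ {r : Ω} {e : E}, r ^ 2 = algebraMap E Ω e → ¬ IsSquare e →
      ∀ x, r ≠ algebraMap E Ω x := by
    rintro r e hr he x rfl
    refine he ⟨x, (algebraMap E Ω).injective ?_⟩
    rw [← hr, map_mul, sq]
  obtain ⟨a, b, hab⟩ := exists_eq_add_mul_of_mem_adjoin_sqrt ht hst
  have hinj := (algebraMap E Ω).injective
  -- Squaring `s = a + b t` puts `2ab t` into `E`, so `2ab = 0`. Here `b = 0` would put `s` into
  -- `E`, and `a = 0` gives `cd = (bd)²`.
  have hsq : algebraMap E Ω (2 * a * b) * t = algebraMap E Ω (c - a ^ 2 - b ^ 2 * d) := by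
    simp only [map_sub, map_mul, map_pow, ← hs, ← ht, hab, map_ofNat]
    ring
  by_cases hab0 : 2 * a * b = 0
  · rcases mul_eq_zero.1 hab0 with h | h
    · have ha : a = 0 := by simpa using h
      refine ⟨b * d, hinj ?_⟩
      simp only [map_mul, ← hs, ← ht, hab, ha, map_zero]
      ring
    · exact absurd (by simp [hab, h]) (hnot hs hc a)
  · refine absurd ?_ (hnot ht hd ((c - a ^ 2 - b ^ 2 * d) / (2 * a * b)))
    rw [map_div₀, eq_div_iff (by simpa only [ne_eq, map_eq_zero] using hab0), ← hsq, mul_comm]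

open IntermediateField in
/-- Given finitely many irreducible polynomials over `E` and a sequence `c` in `E`, either one of the
products `c n` or `c m * c n` with `n` large is already a square, or a square root of some `c n` with
`n` large can be adjoined such that the polynomials stay irreducible. -/
theorem isSquare_or_exists_irreducible_map_adjoin_sqrt {E Ω : Type*} [Field E] [CharZero E]
    [Field Ω] [IsAlgClosed Ω] [Algebra E Ω] (S : Finset E[X]) (hS : ∀ q ∈ S, Irreducible q)
    (c : ℕ → E) (N : ℕ) :
    (∃ n ≥ N, IsSquare (c n) ∨ ∃ m < n, IsSquare (c m * c n)) ∨
    ∃ n ≥ N, ∃ s : Ω, s ^ 2 = algebraMap E Ω (c n) ∧ s ∉ (algebraMap E Ω).range ∧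
      ∀ q ∈ S, Irreducible (q.map (algebraMap E E⟮s⟯)) := by
  classical
  by_contra! H
  obtain ⟨H1, H2⟩ := H
  choose s hs using fun n => IsAlgClosed.exists_pow_nat_eq (algebraMap E Ω (c n)) two_pos
  have hsE : ∀ n ≥ N, s n ∉ (algebraMap E Ω).range := by
    rintro n hn ⟨x, hx⟩
    refine (H1 n hn).1 ⟨x, (algebraMap E Ω).injective ?_⟩
    rw [← hs, ← hx, map_mul, sq]
  have hroot : ∀ q ∈ S, ∃ θ : Ω, aeval θ q = 0 := fun q hq =>
    IsAlgClosed.exists_aeval_eq_zero Ω q (hS q hq).degree_pos.ne'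
  choose! θ hθ using hroot
  -- `M` contains one root of each polynomial. It is finite and separable over `E`, hence has
  -- finitely many intermediate fields.
  let M : IntermediateField E Ω := adjoin E (θ '' (S : Set E[X]))
  have hfin : FiniteDimensional E M := by
    have : Finite (θ '' (S : Set E[X])) := (S.finite_toSet.image θ).to_subtype
    refine finiteDimensional_adjoin ?_
    rintro _ ⟨q, hq, rfl⟩
    exact IsAlgebraic.isIntegral ⟨q, (hS q hq).ne_zero, hθ q hq⟩
  have : Finite (IntermediateField E M) :=
    (Field.exists_primitive_element_iff_finite_intermediateField E M).1
      ⟨inferInstance, Field.exists_primitive_element E M⟩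
  have hsM : ∀ n, s (n + N) ∈ M := by
    intro n
    obtain ⟨q, hq, hirr⟩ := H2 (n + N) (Nat.le_add_left _ _) _ (hs _) (hsE _ (Nat.le_add_left _ _))
    by_contra hn
    refine hirr ((hS q hq).map_adjoin_sqrt (hθ q hq) (hs _) fun hmem => hn ?_)
    exact (adjoin_simple_le_iff.2 (subset_adjoin E _ (Set.mem_image_of_mem θ hq))) hmem
  obtain ⟨m, n, hmn, heq⟩ := Finite.exists_ne_map_eq_of_infinite
    fun n => E⟮(⟨s (n + N), hsM n⟩ : M)⟯
  have hs' : ∀ n, (⟨s (n + N), hsM n⟩ : M) ^ 2 = algebraMap E M (c (n + N)) := fun n =>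
    Subtype.ext (hs _)
  have hsq := fun n => (H1 (n + N) (Nat.le_add_left _ _)).1
  have hprod : IsSquare (c (m + N) * c (n + N)) :=
    isSquare_mul_of_adjoin_sqrt_eq (hs' m) (hs' n) (hsq m) (hsq n)
      (by rw [← heq]; exact mem_adjoin_simple_self _ _)
  rcases lt_or_gt_of_ne hmn with h | h
  · exact (H1 (n + N) (by omega)).2 (m + N) (by omega) hprod
  · exact (H1 (m + N) (by omega)).2 (n + N) (by omega) (mul_comm (c (m + N)) _ ▸ hprod)

/-! ### Level signs of tree automorphisms -/

/-- The vertices of the `n`-th level of the regular tree. -/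
abbrev RegularTreeLevel (d n : ℕ) : Type :=
  {l : List (Fin d) // l.length = n}

instance (d n : ℕ) : Fintype (RegularTreeLevel d n) :=
  inferInstanceAs (Fintype (List.Vector (Fin d) n))

theorem card_regularTreeLevel (d n : ℕ) : Fintype.card (RegularTreeLevel d n) = d ^ n := by
  have h := card_vector (α := Fin d) n
  rw [Fintype.card_fin] at h
  exact h

namespace AutRegularTree

variable {d : ℕ}

theorem apply_nil (φ : AutRegularTree d) : φ [] = [] := by
  cases h : φ [] with
  | nil => rfl
  | cons i w =>
    have h1 : RegularTreeEdge d (φ []) (φ (φ.symm w)) := ⟨i, by simp [h]⟩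
    obtain ⟨j, hj⟩ := φ.map_rel_iff.1 h1
    simp at hj

theorem length_apply (φ : AutRegularTree d) (l : List (Fin d)) : (φ l).length = l.length := by
  induction l with
  | nil => rw [apply_nil]
  | cons i w ih =>
    obtain ⟨j, hj⟩ := φ.map_rel_iff.2 (show RegularTreeEdge d (i :: w) w from ⟨i, rfl⟩)
    rw [hj, List.length_cons, ih, List.length_cons]

/-- The action of a tree automorphism on the `n`-th level of the tree. -/
def levelPerm (n : ℕ) : AutRegularTree d →* Equiv.Perm (RegularTreeLevel d n) where
  toFun φ :=
    { toFun := fun l => ⟨φ l.1, (length_apply φ _).trans l.2⟩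
      invFun := fun l => ⟨φ.symm l.1, (length_apply φ.symm _).trans l.2⟩
      left_inv := fun _ => Subtype.ext (φ.symm_apply_apply _)
      right_inv := fun _ => Subtype.ext (φ.apply_symm_apply _) }
  map_one' := rfl
  map_mul' _ _ := rfl

@[simp]
theorem coe_levelPerm_apply (n : ℕ) (φ : AutRegularTree d) (l : RegularTreeLevel d n) :
    (levelPerm n φ l).1 = φ l.1 := rfl

/-- The sign of the action of a tree automorphism on the `n`-th level of the tree. -/
def levelSign (n : ℕ) : AutRegularTree d →* ℤˣ :=
  Equiv.Perm.sign.comp (levelPerm n)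

/-- Apply a permutation to the letter that precedes the suffix `w`. -/
def permuteAbove (w : List (Fin d)) (π : Equiv.Perm (Fin d)) : List (Fin d) → List (Fin d)
  | [] => []
  | i :: l => (if l = w then π i else i) :: permuteAbove w π l

theorem permuteAbove_of_length_le (w : List (Fin d)) (π : Equiv.Perm (Fin d)) (l : List (Fin d))
    (h : l.length ≤ w.length) : permuteAbove w π l = l := by
  induction l with
  | nil => rfl
  | cons i l ih =>
    rw [List.length_cons] at h
    rw [permuteAbove, ih (by omega), if_neg (by rintro rfl; omega)]

theorem permuteAbove_permuteAbove (w : List (Fin d)) (π ρ : Equiv.Perm (Fin d))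
    (h : ρ * π = 1) (l : List (Fin d)) : permuteAbove w ρ (permuteAbove w π l) = l := by
  induction l with
  | nil => rfl
  | cons i l ih =>
    have hiff : permuteAbove w π l = w ↔ l = w := by
      constructor
      · intro h'
        rw [← ih, h', permuteAbove_of_length_le w ρ w le_rfl]
      · rintro rfl
        exact permuteAbove_of_length_le _ _ _ le_rfl
    simp only [permuteAbove, ih, hiff]
    split_ifs
    · rw [← Equiv.Perm.mul_apply, h, Equiv.Perm.one_apply]
    · rfl

theorem permuteAbove_edge (w : List (Fin d)) (π : Equiv.Perm (Fin d)) {l m : List (Fin d)}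
    (h : RegularTreeEdge d l m) :
    RegularTreeEdge d (permuteAbove w π l) (permuteAbove w π m) := by
  obtain ⟨i, rfl⟩ := h
  exact ⟨_, rfl⟩

/-- The tree automorphism that permutes the subtrees above the vertex `w`. -/
def permAbove (w : List (Fin d)) (π : Equiv.Perm (Fin d)) : AutRegularTree d where
  toFun := permuteAbove w π
  invFun := permuteAbove w π⁻¹
  left_inv := permuteAbove_permuteAbove w π π⁻¹ (inv_mul_cancel π)
  right_inv := permuteAbove_permuteAbove w π⁻¹ π (mul_inv_cancel π)
  map_rel_iff' := by
    intro l m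
    refine ⟨fun h => ?_, permuteAbove_edge w π⟩
    have := permuteAbove_edge w π⁻¹ h
    simpa only [Equiv.coe_fn_mk, permuteAbove_permuteAbove w π π⁻¹ (inv_mul_cancel π)] using this

theorem levelSign_permAbove_of_le (w : List (Fin d)) (π : Equiv.Perm (Fin d)) {n : ℕ}
    (hn : n ≤ w.length) : levelSign n (permAbove w π) = 1 := by
  have : levelPerm n (permAbove w π) = 1 :=
    Equiv.ext fun l => Subtype.ext (permuteAbove_of_length_le w π _ (l.2.le.trans hn))
  rw [levelSign, MonoidHom.comp_apply, this, map_one]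

/-- On the level just above `w` only two children of `w` are exchanged. Together with triviality on
lower levels, this makes the level signs triangular on these automorphisms. -/
theorem levelSign_permAbove_swap (w : List (Fin d)) {i j : Fin d} (hij : i ≠ j) :
    levelSign (w.length + 1) (permAbove w (Equiv.swap i j)) = -1 := by
  have : levelPerm (w.length + 1) (permAbove w (Equiv.swap i j)) =
      Equiv.swap ⟨i :: w, rfl⟩ ⟨j :: w, rfl⟩ := by
    ext1 ⟨l, hl⟩
    apply Subtype.ext
    rw [coe_levelPerm_apply]
    change permuteAbove w (Equiv.swap i j) l = _
    cases l with
    | nil => simp at hl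
    | cons a l =>
      rw [List.length_cons, Nat.add_right_cancel_iff] at hl
      rw [permuteAbove, permuteAbove_of_length_le _ _ _ hl.le]
      by_cases h : l = w
      · subst h
        simp only [if_true, Equiv.swap_apply_def]
        simp only [Subtype.mk.injEq, List.cons.injEq, and_true]
        split_ifs <;> rfl
      · rw [if_neg h, Equiv.swap_apply_of_ne_of_ne]
        · intro h'
          exact h (List.cons.inj (congrArg Subtype.val h')).2
        · intro h'
          exact h (List.cons.inj (congrArg Subtype.val h')).2
  rw [levelSign, MonoidHom.comp_apply, this, Equiv.Perm.sign_swap]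
  intro h
  exact hij (List.cons.inj (congrArg Subtype.val h)).1

/-- A group of automorphisms of the regular tree has infinite index if its level signs satisfy
infinitely many independent relations. -/
theorem not_finiteIndex_of_levelSign (hd : 2 ≤ d) (H : Subgroup (AutRegularTree d))
    (hH : ∀ N, ∃ n ≥ N, (∀ φ ∈ H, levelSign n φ = 1) ∨
      ∃ m < n, ∀ φ ∈ H, levelSign m φ * levelSign n φ = 1) : ¬ H.FiniteIndex := by
  intro hfin
  let i : Fin d := ⟨0, by omega⟩
  let j : Fin d := ⟨1, by omega⟩
  have hij : i ≠ j := by simp [i, j]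
  let τ : ℕ → AutRegularTree d := fun n => permAbove (List.replicate n i) (Equiv.swap i j)
  have hτ : ∀ m n, m ≤ n → levelSign m (τ n) = 1 := fun m n h =>
    levelSign_permAbove_of_le _ _ (by simpa using h)
  have hτ' : ∀ n, levelSign (n + 1) (τ n) = -1 := fun n => by
    have := levelSign_permAbove_swap (List.replicate n i) hij
    rwa [List.length_replicate] at this
  have hχ : ∀ N, ∃ n ≥ N, ∃ χ : AutRegularTree d →* ℤˣ, (∀ φ ∈ H, χ φ = 1) ∧
      χ (τ n) = -1 ∧ ∀ m > n, χ (τ m) = 1 := by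
    intro N
    -- Asking for a level at least `N + 1` makes it positive, hence of the form `n + 1`, the level
    -- on which `τ n` is odd.
    obtain ⟨n, hn, h⟩ := hH (N + 1)
    obtain ⟨n, rfl⟩ : ∃ k, n = k + 1 := ⟨n - 1, by omega⟩
    refine ⟨n, by omega, ?_⟩
    rcases h with h | ⟨m, hm, h⟩
    · exact ⟨levelSign (n + 1), h, hτ' n, fun m hm => hτ _ _ hm⟩
    · refine ⟨levelSign m * levelSign (n + 1), h, ?_, fun k hk => ?_⟩
      · rw [MonoidHom.mul_apply, hτ' n, hτ m n (by omega), one_mul]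
      · rw [MonoidHom.mul_apply, hτ m k (by omega), hτ _ _ hk, one_mul]
  choose! g hg χ hχH hχg hχlt using hχ
  let J : Set ℕ := Set.range g
  have hJ : J.Infinite := Set.infinite_of_not_bddAbove fun ⟨B, hB⟩ => by
    have h1 := hB (Set.mem_range_self (B + 1))
    have h2 := hg (B + 1)
    omega
  have : Infinite J := hJ.to_subtype
  obtain ⟨⟨_, a, rfl⟩, ⟨_, b, rfl⟩, hne, heq⟩ := Finite.exists_ne_map_eq_of_infinite
    fun n : J => (QuotientGroup.mk (τ n) : AutRegularTree d ⧸ H)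
  have hne' : g a ≠ g b := fun h => hne (Subtype.ext h)
  -- The character `χ a` is trivial on `H` but separates `τ (g a)` from every later `τ (g b)`, so
  -- their cosets differ.
  have key : ∀ a b, g a < g b →
      (QuotientGroup.mk (τ (g a)) : AutRegularTree d ⧸ H) ≠ QuotientGroup.mk (τ (g b)) := by
    intro a b hab heq
    have h1 := hχH a _ (QuotientGroup.eq.1 heq)
    rw [map_mul, map_inv, hχg, hχlt a _ hab] at h1
    exact absurd h1 (by decide)
  rcases lt_or_gt_of_ne hne' with h | h
  · exact key a b h heq
  · exact key b a h heq.symm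

end AutRegularTree

/-! ### Discriminants and signs of root permutations -/

/-- A square multiple of the discriminant of a polynomial. -/
noncomputable def Polynomial.scaledDiscr {R : Type*} [CommRing R] (p : R[X]) : R :=
  (∏ i : Fin p.natDegree, ∏ _j ∈ Finset.Ioi i, (-1)) *
    (p.leadingCoeff * resultant p (derivative p) p.natDegree (p.natDegree - 1))

theorem Polynomial.scaledDiscr_map {R S : Type*} [CommRing R] [CommRing S] {i : R →+* S}
    (hi : Function.Injective i) (p : R[X]) : (p.map i).scaledDiscr = i p.scaledDiscr := by
  simp only [scaledDiscr, leadingCoeff_map_of_injective hi, map_mul, map_prod, map_neg, map_one]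
  rw [natDegree_map_eq_of_injective hi, derivative_map, resultant_map_map]

/-- The resultant is a power of the leading coefficient times the product of the values of `p'` at
the roots, and these values are products of root differences. Pairing `(i, j)` with `(j, i)` yields
the squared Vandermonde determinant and a sign, which the sign in `scaledDiscr` cancels. -/
theorem Polynomial.scaledDiscr_eq_sq_det_vandermonde {F : Type*} [Field F] {p : F[X]}
    (hp : 1 ≤ p.natDegree) (β : Fin p.natDegree → F)
    (hβ : p = C p.leadingCoeff * Lagrange.nodal Finset.univ β) :
    p.scaledDiscr = (p.leadingCoeff ^ p.natDegree * (Matrix.vandermonde β).det) ^ 2 := by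
  have hp0 : p ≠ 0 := by rintro rfl; simp at hp
  have hsplit : p.Splits := by
    rw [hβ]
    refine (Splits.C _).mul (Splits.prod fun i _ => Splits.X_sub_C _)
  have hroots : p.roots = Finset.univ.val.map β := by
    conv_lhs => rw [hβ, roots_C_mul _ (leadingCoeff_ne_zero.2 hp0), Lagrange.nodal]
    rw [roots_prod _ _ (Finset.prod_ne_zero_iff.2 fun i _ => X_sub_C_ne_zero _)]
    simp [Multiset.bind_singleton]
  have hder : ∀ i, (derivative p).eval (β i) =
      p.leadingCoeff * ∏ j ∈ Finset.univ.erase i, (β i - β j) := by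
    intro i
    conv_lhs => rw [hβ, derivative_C_mul, eval_mul, eval_C,
      Lagrange.eval_nodal_derivative_eval_node_eq (Finset.mem_univ i),
      Lagrange.eval_nodal]
  have hpair : ∏ i, ∏ j ∈ Finset.univ.erase i, (β i - β j) =
      (∏ i : Fin p.natDegree, ∏ _j ∈ Finset.Ioi i, (-1)) * (Matrix.vandermonde β).det ^ 2 := by
    have h1 := Finset.prod_prod_Ioi_mul_eq_prod_prod_off_diag (fun i j => β j - β i)
    simp only [Finset.compl_singleton] at h1
    rw [← h1, Matrix.det_vandermonde, sq]
    simp only [← Finset.prod_mul_distrib]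
    refine Finset.prod_congr rfl fun i _ => Finset.prod_congr rfl fun j _ => ?_
    ring
  have hsign : (∏ i : Fin p.natDegree, ∏ _j ∈ Finset.Ioi i, (-1 : F)) *
      (∏ i : Fin p.natDegree, ∏ _j ∈ Finset.Ioi i, (-1 : F)) = 1 := by
    simp only [← Finset.prod_mul_distrib]
    simp
  rw [scaledDiscr, resultant_eq_prod_eval _ _ _ (natDegree_derivative_le p) hsplit, hroots,
    Multiset.map_map]
  change _ * (_ * (_ * ∏ i, (derivative p).eval (β i))) = _
  simp only [hder]
  rw [Finset.prod_mul_distrib, hpair, Finset.prod_const, Finset.card_univ, Fintype.card_fin]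
  obtain ⟨m, hm⟩ : ∃ m, p.natDegree = m + 1 := ⟨p.natDegree - 1, by omega⟩
  have h3 : p.leadingCoeff * p.leadingCoeff ^ (p.natDegree - 1) = p.leadingCoeff ^ p.natDegree := by
    rw [← pow_succ', hm]; simp
  generalize (∏ i : Fin p.natDegree, ∏ _j ∈ Finset.Ioi i, (-1 : F)) = ε at hsign ⊢
  linear_combination (p.leadingCoeff ^ p.natDegree) ^ 2 * (Matrix.vandermonde β).det ^ 2 * hsign +
    ε ^ 2 * p.leadingCoeff ^ p.natDegree * (Matrix.vandermonde β).det ^ 2 * h3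

/-- A permutation of the roots that comes from a field automorphism multiplies a suitable square root
of the discriminant by the sign of the permutation. -/
theorem Polynomial.exists_sqrt_scaledDiscr {F Ω ι : Type*} [Field F] [Field Ω] [Algebra F Ω]
    [Fintype ι] [DecidableEq ι] {p : F[X]} (hp : 1 ≤ p.natDegree) (α : ι → Ω)
    (hα : Function.Injective α) (hcard : Fintype.card ι = p.natDegree)
    (hroot : ∀ i, aeval (α i) p = 0) :
    ∃ D : Ω, D ≠ 0 ∧ D ^ 2 = algebraMap F Ω p.scaledDiscr ∧
      ∀ (g : Ω →ₐ[F] Ω) (σ : Equiv.Perm ι), (∀ i, g (α i) = α (σ i)) →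
        g D = ((Equiv.Perm.sign σ : ℤ) : Ω) * D := by
  set q := p.map (algebraMap F Ω) with hq
  have hqdeg : q.natDegree = p.natDegree := natDegree_map _
  have hq0 : q ≠ 0 := by rintro h0; rw [h0] at hqdeg; simp at hqdeg; omega
  let e : ι ≃ Fin q.natDegree := Fintype.equivFinOfCardEq (hcard.trans hqdeg.symm)
  let β : Fin q.natDegree → Ω := α ∘ e.symm
  have hβ : Function.Injective β := hα.comp e.symm.injective
  have hnodal : q = C q.leadingCoeff * Lagrange.nodal Finset.univ β := by
    have hdvd : Lagrange.nodal Finset.univ β ∣ q := by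
      refine Finset.prod_dvd_of_coprime (fun i _ j _ hij => ?_) fun i _ => ?_
      · exact pairwise_coprime_X_sub_C hβ hij
      · rw [dvd_iff_isRoot, IsRoot.def, hq, eval_map_algebraMap]
        exact hroot _
    refine eq_leadingCoeff_mul_of_monic_of_dvd_of_natDegree_le Lagrange.nodal_monic hdvd ?_
    rw [Lagrange.natDegree_nodal, Finset.card_univ, Fintype.card_fin]
  refine ⟨q.leadingCoeff ^ q.natDegree * (Matrix.vandermonde β).det, ?_, ?_, ?_⟩
  · exact mul_ne_zero (pow_ne_zero _ (leadingCoeff_ne_zero.2 hq0))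
      (Matrix.det_vandermonde_ne_zero_iff.2 hβ)
  · rw [← scaledDiscr_eq_sq_det_vandermonde (hqdeg ▸ hp) β hnodal,
      scaledDiscr_map (algebraMap F Ω).injective]
  · intro g σ hg
    -- Applying `g` to the entries permutes the rows of the Vandermonde matrix. The numbering `e` of
    -- the roots does not affect the sign.
    have h1 : g (Matrix.vandermonde β).det = ((Equiv.Perm.sign σ : ℤ) : Ω) *
        (Matrix.vandermonde β).det := by
      rw [← Equiv.Perm.sign_permCongr e σ, ← Matrix.det_permute, AlgHom.map_det]
      congr 1
      ext i j
      simp [Matrix.vandermonde_apply, β, hg]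
    have h2 : g q.leadingCoeff = q.leadingCoeff := by
      rw [hq, leadingCoeff_map, AlgHom.commutes]
    rw [map_mul, h1, map_pow, h2]
    ring

/-! ### From square discriminants to infinite index -/

section Arboreal

variable {F : Type u} [Field F]

/-- An identification of the preimage tree with the regular tree preserves levels. -/
theorem level_preimageTree_iso_symm {d : ℕ} {f : F[X]}
    (e : PreimageEdge f ≃r RegularTreeEdge d) (l : List (Fin d)) :
    (e.symm l).1.1 = l.length := by
  induction l with
  | nil =>
    rcases hv : e.symm [] with ⟨⟨n, α⟩, h⟩
    cases n with
    | zero => rfl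
    | succ n =>
      -- A vertex of positive level has an outgoing edge, whereas the root of the regular tree has
      -- none.
      have h1 : PreimageEdge f (e.symm []) ⟨(n, aeval α f), h⟩ := by
        rw [hv]
        exact ⟨rfl, rfl⟩
      obtain ⟨i, hi⟩ := e.map_rel_iff.2 h1
      simp at hi
  | cons i w ih =>
    have h1 : PreimageEdge f (e.symm (i :: w)) (e.symm w) := e.symm.map_rel_iff.2 ⟨i, rfl⟩
    rw [h1.1, ih, List.length_cons]

theorem natDegree_iterate_comp_X (f : F[X]) (n : ℕ) :
    (f.comp^[n] X).natDegree = f.natDegree ^ n := by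
  induction n with
  | zero => simp
  | succ n ih => rw [Function.iterate_succ_apply', natDegree_comp, ih, pow_succ']

theorem map_iterate_comp_X {K L : Type*} [Field K] [Field L] (i : K →+* L) (f : K[X]) (n : ℕ) :
    (f.comp^[n] X).map i = (f.map i).comp^[n] X := by
  induction n with
  | zero => simp
  | succ n ih => rw [Function.iterate_succ_apply', Polynomial.map_comp, ih,
      Function.iterate_succ_apply']

/-- The Galois group acts on a square root of the discriminant of an iterate of `f` through the sign
of its action on the corresponding level of the tree. -/
theorem exists_sqrt_scaledDiscr_iterate (f : F[X]) (hf : SeparableIterates f)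
    (hd : 2 ≤ f.natDegree) (n : ℕ) :
    ∃ D : AlgebraicClosure F, D ≠ 0 ∧
      D ^ 2 = algebraMap F (AlgebraicClosure F) (f.comp^[n] X).scaledDiscr ∧
      ∀ g : Field.absoluteGaloisGroup F,
        AlgEquiv.toAlgHom g D =
          ((AutRegularTree.levelSign n (arborealRep f hf g) : ℤ) : AlgebraicClosure F) * D := by
  let e := (nonempty_preimageTree_iso f hf).some
  let α : RegularTreeLevel f.natDegree n → AlgebraicClosure F := fun l => (e.symm l.1).1.2
  have hlevel : ∀ l : RegularTreeLevel f.natDegree n, (e.symm l.1).1.1 = n := fun l =>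
    (level_preimageTree_iso_symm e l.1).trans l.2
  obtain ⟨D, hD0, hD, hg⟩ := exists_sqrt_scaledDiscr (p := f.comp^[n] X) (α := α)
    (by rw [natDegree_iterate_comp_X]; exact Nat.one_le_pow _ _ (by omega))
    (fun l m h => Subtype.ext (e.symm.injective
      (Subtype.ext (Prod.ext ((hlevel l).trans (hlevel m).symm) h))))
    (by rw [card_regularTreeLevel, natDegree_iterate_comp_X])
    (fun l => by
      have := (e.symm l.1).2
      rw [hlevel] at this
      rw [aeval_iterate_comp_X]
      exact this)
  refine ⟨D, hD0, hD, fun g => hg _ (AutRegularTree.levelPerm n (arborealRep f hf g)) fun l => ?_⟩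
  have h1 : e.symm (arborealRep f hf g l.1) = galoisVertex f g (e.symm l.1) :=
    e.symm_apply_apply _
  change g.toFun (α l) = (e.symm (arborealRep f hf g l.1)).1.2
  rw [h1]
  rfl

/-- If products of discriminants of iterates of `f` are squares for infinitely many iterates, then the
image of the arboreal representation has infinite index. -/
theorem not_finiteIndex_range_arborealRep [CharZero F] (f : F[X]) (hf : SeparableIterates f)
    (hd : 2 ≤ f.natDegree)
    (hsq : ∀ N, ∃ n ≥ N, IsSquare (f.comp^[n] X).scaledDiscr ∨
      ∃ m < n, IsSquare ((f.comp^[m] X).scaledDiscr * (f.comp^[n] X).scaledDiscr)) :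
    ¬ (arborealRep f hf).range.FiniteIndex := by
  choose D hD0 hD hg using exists_sqrt_scaledDiscr_iterate f hf hd
  -- A square root of a square of `F` lies in `F` and is fixed by Galois; being nonzero, it forces
  -- `ε = 1` in characteristic zero.
  have key : ∀ (a : F) (B : AlgebraicClosure F) (g : Field.absoluteGaloisGroup F) (ε : ℤˣ),
      IsSquare a → B ≠ 0 → B ^ 2 = algebraMap F (AlgebraicClosure F) a →
      AlgEquiv.toAlgHom g B = ((ε : ℤ) : AlgebraicClosure F) * B → ε = 1 := by
    rintro a B g ε ⟨s, rfl⟩ hB0 hB hgB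
    have hfix : AlgEquiv.toAlgHom g B = B := by
      rw [map_mul, ← sq] at hB
      rcases sq_eq_sq_iff_eq_or_eq_neg.1 hB with h | h
      · rw [h, AlgHom.commutes]
      · rw [h, map_neg, AlgHom.commutes]
    rcases Int.units_eq_one_or ε with h | rfl
    · exact h
    · rw [hfix, Units.val_neg, Units.val_one, Int.cast_neg, Int.cast_one, neg_one_mul,
        self_eq_neg] at hgB
      exact absurd hgB hB0
  refine AutRegularTree.not_finiteIndex_of_levelSign hd _ fun N => ?_
  obtain ⟨n, hn, h⟩ := hsq N
  refine ⟨n, hn, ?_⟩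
  rcases h with h | ⟨m, hm, h⟩
  · left
    rintro _ ⟨g, rfl⟩
    exact key _ (D n) g _ h (hD0 n) (hD n) (hg n g)
  · right
    refine ⟨m, hm, ?_⟩
    rintro _ ⟨g, rfl⟩
    refine key _ (D m * D n) g _ h (mul_ne_zero (hD0 m) (hD0 n)) ?_ ?_
    · rw [mul_pow, hD, hD, map_mul]
    · rw [map_mul, hg, hg]
      push_cast
      ring

end Arboreal

/-! ### Approximating fields and the generic chain -/

section Generic

variable (k : Type u) [Field k]

/-- A finite approximation of the field to be constructed: a Hilbertian extension of `k` whose degree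
is a power of `2`, with finitely many irreducible polynomials that shall remain irreducible. -/
structure ApproxField where
  /-- The approximating field. -/
  field : IntermediateField k (AlgebraicClosure k)
  /-- The polynomials that have to remain irreducible. -/
  polys : Finset (AlgebraicClosure k)[X]
  isHilbertian : IsHilbertian field
  finrank_eq : ∃ m : ℕ, Module.finrank k field = 2 ^ m
  irreducible : ∀ h ∈ polys, ∃ q : field[X],
    q.map (algebraMap field (AlgebraicClosure k)) = h ∧ Irreducible q

/-- A larger element has a larger field and keeps all earlier promises. The polynomials live over
the algebraic closure so that those of different stages can be compared. -/
noncomputable instance : Preorder (ApproxField k) :=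
  Preorder.lift fun p => (p.field, p.polys)

variable {k}

theorem ApproxField.field_mono {p q : ApproxField k} (h : p ≤ q) : p.field ≤ q.field := h.1

theorem ApproxField.polys_mono {p q : ApproxField k} (h : p ≤ q) : p.polys ⊆ q.polys := h.2

/-- One of the discriminants of late iterates of `f`, or a product of two of them, is a square. -/
def HasSquareDiscr (f : (AlgebraicClosure k)[X]) (N : ℕ) (p : ApproxField k) : Prop :=
  ∃ n ≥ N, (∃ t ∈ p.field, t ^ 2 = (f.comp^[n] X).scaledDiscr) ∨
    ∃ m < n, ∃ t ∈ p.field, t ^ 2 = (f.comp^[m] X).scaledDiscr * (f.comp^[n] X).scaledDiscr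

/-- Some specialization of `g` outside of `A` has to remain irreducible. -/
def HasSpecialization (g : (AlgebraicClosure k)[X][X]) (A : Finset (AlgebraicClosure k))
    (p : ApproxField k) : Prop :=
  ∃ a ∈ p.field, a ∉ A ∧ g.map (evalRingHom a) ∈ p.polys

theorem map_evalRingHom_algebraMap {K L : Type*} [Field K] [Field L] [Algebra K L] (g : K[X][X])
    (a : K) : (g.map (evalRingHom a)).map (algebraMap K L) =
      (g.map (mapRingHom (algebraMap K L))).map (evalRingHom (algebraMap K L a)) := by
  simp only [Polynomial.map_map]
  congr 1
  ext <;> simp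

/-- The field stays the same: Hilbertianity supplies a good value outside the finite set `A`, and
the specialized polynomial is added to the promises. -/
theorem ApproxField.exists_hasSpecialization (p : ApproxField k) (g : p.field[X][X])
    (hg : Irreducible g) (hdeg : 1 ≤ g.natDegree) (A : Finset (AlgebraicClosure k)) :
    ∃ q ≥ p, HasSpecialization
      (g.map (mapRingHom (algebraMap p.field (AlgebraicClosure k)))) A q := by
  classical
  obtain ⟨a, ha, haA⟩ := (p.isHilbertian g hg hdeg).exists_notMem_finite
    (A.finite_toSet.preimage (f := algebraMap p.field (AlgebraicClosure k))
      (algebraMap p.field (AlgebraicClosure k)).injective.injOn)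
  refine ⟨⟨p.field, insert ((g.map (evalRingHom a)).map (algebraMap _ _)) p.polys,
    p.isHilbertian, p.finrank_eq, ?_⟩, ⟨le_rfl, Finset.subset_insert _ _⟩,
    a, a.2, haA, Finset.mem_insert.2 (Or.inl ?_)⟩
  · intro h hh
    rcases Finset.mem_insert.1 hh with rfl | hh
    · exact ⟨_, rfl, ha⟩
    · exact p.irreducible h hh
  · exact (map_evalRingHom_algebraMap g a).symm

open IntermediateField in
/-- Adjoin a square root to an approximating field. -/
theorem ApproxField.exists_adjoin_sqrt [CharZero k] (p : ApproxField k) {s : AlgebraicClosure k}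
    {c : p.field} (hs : s ^ 2 = algebraMap p.field (AlgebraicClosure k) c)
    (hsE : s ∉ (algebraMap p.field (AlgebraicClosure k)).range)
    (hirr : ∀ h ∈ p.polys, ∃ q : p.field[X],
      q.map (algebraMap p.field (AlgebraicClosure k)) = h ∧
        Irreducible (q.map (algebraMap p.field (p.field)⟮s⟯))) :
    ∃ q ≥ p, s ∈ q.field := by
  have hrank := finrank_adjoin_sqrt hs hsE
  have : Algebra.IsQuadraticExtension p.field (p.field)⟮s⟯ := ⟨hrank⟩
  have hH : IsHilbertian (p.field)⟮s⟯ := p.isHilbertian.of_isQuadraticExtension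
  refine ⟨⟨(p.field)⟮s⟯.restrictScalars k, p.polys, hH, ?_, ?_⟩, ⟨?_, subset_rfl⟩, ?_⟩
  · obtain ⟨m, hm⟩ := p.finrank_eq
    refine ⟨m + 1, ?_⟩
    have h1 := Module.finrank_mul_finrank k p.field (p.field)⟮s⟯
    rw [hm, hrank] at h1
    rw [pow_succ, h1]
    rfl
  · intro h hh
    obtain ⟨q, rfl, hq⟩ := hirr h hh
    refine ⟨q.map (algebraMap p.field (p.field)⟮s⟯), ?_, hq⟩
    exact Polynomial.map_map (algebraMap p.field (p.field)⟮s⟯)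
      (algebraMap (p.field)⟮s⟯ (AlgebraicClosure k)) q
  · intro x hx
    exact (IntermediateField.algebraMap_mem (p.field)⟮s⟯ (⟨x, hx⟩ : p.field))
  · exact mem_adjoin_simple_self p.field s

/-- Either a suitable square is already present, or a quadratic extension that respects the promises
makes a late discriminant a square. -/
theorem ApproxField.exists_hasSquareDiscr [CharZero k] (p : ApproxField k) (f : p.field[X])
    (N : ℕ) :
    ∃ q ≥ p, HasSquareDiscr (f.map (algebraMap p.field (AlgebraicClosure k))) N q := by
  classical
  choose! r hr hirr using p.irreducible
  have hdisc : ∀ n, ((f.map (algebraMap p.field (AlgebraicClosure k))).comp^[n] X).scaledDiscr =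
      algebraMap p.field (AlgebraicClosure k) (f.comp^[n] X).scaledDiscr := fun n => by
    rw [← map_iterate_comp_X, scaledDiscr_map (algebraMap p.field (AlgebraicClosure k)).injective]
  rcases isSquare_or_exists_irreducible_map_adjoin_sqrt (Ω := AlgebraicClosure k)
    (p.polys.image r) (by simpa using hirr) (fun n => (f.comp^[n] X).scaledDiscr) N with
    ⟨n, hn, h⟩ | ⟨n, hn, s, hs, hsE, h⟩
  · refine ⟨p, le_rfl, n, hn, ?_⟩
    simp only [hdisc]
    rcases h with ⟨t, ht⟩ | ⟨m, hm, t, ht⟩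
    · exact Or.inl ⟨t, t.2, by rw [ht, map_mul, sq]; rfl⟩
    · exact Or.inr ⟨m, hm, t, t.2, by rw [← map_mul, ht, map_mul, sq]; rfl⟩
  · obtain ⟨q, hq, hsq⟩ := p.exists_adjoin_sqrt hs hsE fun h' hh' =>
      ⟨r h', hr h' hh', h _ (Finset.mem_image_of_mem r hh')⟩
    exact ⟨q, hq, n, hn, Or.inl ⟨s, hsq, by rw [hs, hdisc]⟩⟩

/-- If a property `P` can be achieved whenever `Q` holds, then the elements that satisfy `P` or
exclude `Q` for good are cofinal. -/
def Order.Cofinal.ofImp {α : Type*} [Preorder α] (P Q : α → Prop)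
    (h : ∀ p, Q p → ∃ q ≥ p, P q) : Order.Cofinal α where
  carrier := {p | P p ∨ ∀ q ≥ p, ¬ Q q}
  isCofinal p := by
    by_cases hp : ∃ q ≥ p, Q q
    · obtain ⟨q, hpq, hq⟩ := hp
      obtain ⟨r, hqr, hr⟩ := h q hq
      exact ⟨r, Or.inl hr, hpq.trans hqr⟩
    · push Not at hp
      exact ⟨p, Or.inr hp, le_rfl⟩

theorem IsHilbertian.of_ringEquiv {K L : Type*} [Field K] [Field L] (e : K ≃+* L)
    (hK : IsHilbertian K) : IsHilbertian L := by
  intro f hf hdeg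
  let e₁ : L[X] ≃+* K[X] := mapEquiv e.symm
  let e₂ : L[X][X] ≃+* K[X][X] := mapEquiv e₁
  have h1 : Irreducible (e₂ f) := (MulEquiv.irreducible_iff e₂).2 hf
  have h2 : 1 ≤ (e₂ f).natDegree := by
    rwa [show (e₂ f).natDegree = f.natDegree from natDegree_map_eq_of_injective e₁.injective f]
  refine ((hK _ h1 h2).image e.injective.injOn).mono ?_
  rintro _ ⟨a, ha, rfl⟩
  refine (MulEquiv.irreducible_iff e₁).1 ?_
  have h3 : e₁ (f.map (evalRingHom (e a))) = (e₂ f).map (evalRingHom a) := by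
    change (f.map (evalRingHom (e a))).map (e.symm : L →+* K) =
      (f.map (e₁ : L[X] →+* K[X])).map (evalRingHom a)
    simp only [Polynomial.map_map]
    congr 1
    ext <;> simp [e₁]
  rw [h3]
  exact ha

theorem countable_algebraicClosure [Countable k] : Countable (AlgebraicClosure k) := by
  have h := Algebraic.countable k (AlgebraicClosure k)
  have huniv : {x : AlgebraicClosure k | IsAlgebraic k x} = Set.univ :=
    Set.eq_univ_of_forall fun x => Algebra.IsAlgebraic.isAlgebraic x
  rw [huniv] at h
  exact Set.countable_univ_iff.1 h

theorem Polynomial.countable {R : Type*} [Semiring R] [Countable R] : Countable R[X] :=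
  Cardinal.mk_le_aleph0_iff.1
    (cardinalMk_le_max.trans (max_le (Cardinal.mk_le_aleph0_iff.2 inferInstance) le_rfl))

/-- A chain of approximating fields that is generic for all discriminants of iterates and all
specializations. -/
theorem exists_generic_chain [CharZero k] [Countable k] (hk : IsHilbertian k) :
    ∃ p : ℕ → ApproxField k, Monotone p ∧
      (∀ f N, (∀ᶠ n in Filter.atTop, ∃ f₀ : (p n).field[X],
          f₀.map (algebraMap _ (AlgebraicClosure k)) = f) →
        ∃ n, HasSquareDiscr f N (p n)) ∧
      (∀ g A, (∀ᶠ n in Filter.atTop, ∃ g₀ : (p n).field[X][X],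
          g₀.map (mapRingHom (algebraMap _ (AlgebraicClosure k))) = g ∧ Irreducible g₀ ∧
            1 ≤ g₀.natDegree) →
        ∃ n, HasSpecialization g A (p n)) := by
  classical
  have := countable_algebraicClosure (k := k)
  have := Polynomial.countable (R := AlgebraicClosure k)
  have := Polynomial.countable (R := (AlgebraicClosure k)[X])
  let ι := ((AlgebraicClosure k)[X] × ℕ) ⊕ ((AlgebraicClosure k)[X][X] × Finset (AlgebraicClosure k))
  have : Encodable ι := Encodable.ofCountable ι
  let Q₁ : (AlgebraicClosure k)[X] → ApproxField k → Prop := fun f p =>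
    ∃ f₀ : p.field[X], f₀.map (algebraMap _ (AlgebraicClosure k)) = f
  let Q₂ : (AlgebraicClosure k)[X][X] → ApproxField k → Prop := fun g p =>
    ∃ g₀ : p.field[X][X], g₀.map (mapRingHom (algebraMap _ (AlgebraicClosure k))) = g ∧
      Irreducible g₀ ∧ 1 ≤ g₀.natDegree
  -- A task makes sense only over fields that contain its coefficients (and, for `g`, over which it
  -- is irreducible). `ofImp` makes each task cofinal by also admitting stages that exclude it
  -- forever.
  let D : ι → Order.Cofinal (ApproxField k) := Sum.elim
    (fun x => .ofImp (HasSquareDiscr x.1 x.2) (Q₁ x.1) (by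
      rintro p ⟨f₀, hf₀⟩
      rw [← hf₀]
      exact p.exists_hasSquareDiscr f₀ x.2))
    (fun x => .ofImp (HasSpecialization x.1 x.2) (Q₂ x.1) (by
      rintro p ⟨g₀, hg₀, hirr, hdeg⟩
      rw [← hg₀]
      exact p.exists_hasSpecialization g₀ hirr hdeg x.2))
  let p₀ : ApproxField k :=
    { field := ⊥
      polys := ∅
      isHilbertian := hk.of_ringEquiv (IntermediateField.botEquiv k _).symm.toRingEquiv
      finrank_eq := ⟨0, by rw [IntermediateField.finrank_bot, pow_zero]⟩
      irreducible := by simp }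
  let p := Order.sequenceOfCofinals p₀ D
  have hmono : Monotone p := Order.sequenceOfCofinals.monotone p₀ D
  -- A task that makes sense at all large stages was never excluded, so it was fulfilled.
  have key : ∀ (P Q : ApproxField k → Prop) (n : ℕ), (P (p n) ∨ ∀ q ≥ p n, ¬ Q q) →
      (∀ᶠ m in Filter.atTop, Q (p m)) → P (p n) := by
    intro P Q n h hQ
    refine h.resolve_right fun h' => ?_
    obtain ⟨m, hm, hnm⟩ := (hQ.and (Filter.eventually_ge_atTop n)).exists
    exact h' (p m) (hmono hnm) hm
  refine ⟨p, hmono, fun f N hf => ⟨Encodable.encode (Sum.inl (f, N) : ι) + 1, ?_⟩,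
    fun g A hg => ⟨Encodable.encode (Sum.inr (g, A) : ι) + 1, ?_⟩⟩
  · exact key _ (Q₁ f) _ (Order.sequenceOfCofinals.encode_mem p₀ D (Sum.inl (f, N))) hf
  · exact key _ (Q₂ g) _ (Order.sequenceOfCofinals.encode_mem p₀ D (Sum.inr (g, A))) hg

end Generic

/-! ### Descent to the stages and passage to the union -/

theorem Polynomial.isLocalHom_mapRingHom {R S : Type*} [CommRing R] [IsDomain R] [CommRing S]
    [IsDomain S] {φ : R →+* S} (hφ : Function.Injective φ) [IsLocalHom φ] :
    IsLocalHom (mapRingHom φ) := by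
  refine ⟨fun p hp => ?_⟩
  obtain ⟨r, hr, hrp⟩ := Polynomial.isUnit_iff.1 hp
  have hdeg : p.natDegree = 0 := by
    rw [← natDegree_map_eq_of_injective hφ, ← coe_mapRingHom, ← hrp, natDegree_C]
  obtain ⟨a, rfl⟩ := natDegree_eq_zero.1 hdeg
  rw [coe_mapRingHom, map_C, C_inj] at hrp
  rw [hrp] at hr
  exact (isUnit_of_map_unit φ a hr).map C

/-- Extension of the coefficient field reflects units. This descends irreducibility from the union
to a stage. -/
theorem Irreducible.of_map_map {K L : Type*} [Field K] [Field L] {φ : K →+* L} {g : K[X][X]}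
    (hg : Irreducible (g.map (mapRingHom φ))) : Irreducible g := by
  have := isLocalHom_mapRingHom φ.injective
  have := isLocalHom_mapRingHom (φ := mapRingHom φ) (map_injective φ φ.injective)
  exact Irreducible.of_map (f := mapRingHom (mapRingHom φ)) hg

section Union

variable {k Ω : Type u} [Field k] [Field Ω] [Algebra k Ω]

theorem IntermediateField.exists_map_eq {E : IntermediateField k Ω} {f : Polynomial Ω}
    (hf : ∀ j, f.coeff j ∈ E) : ∃ q : Polynomial E, q.map (algebraMap E Ω) = f := by
  refine (mem_lifts f).1 ((lifts_iff_coeff_lifts f).2 fun j => ?_)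
  exact ⟨⟨_, hf j⟩, rfl⟩

theorem IntermediateField.exists_map_map_eq {E : IntermediateField k Ω} {g : Polynomial (Polynomial Ω)}
    (hg : ∀ i j, (g.coeff i).coeff j ∈ E) :
    ∃ q : Polynomial (Polynomial E), q.map (mapRingHom (algebraMap E Ω)) = g := by
  refine (mem_lifts g).1 ((lifts_iff_coeff_lifts g).2 fun i => ?_)
  exact exists_map_eq (hg i)

variable {E : ℕ → IntermediateField k Ω}

theorem IntermediateField.mem_iSup_of_monotone (hE : Monotone E) {x : Ω} : x ∈ ⨆ n, E n ↔ ∃ n, x ∈ E n := by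
  rw [← SetLike.mem_coe, coe_iSup_of_directed hE.directed_le, Set.mem_iUnion]
  rfl

theorem IntermediateField.eventually_mem_of_finset (hE : Monotone E) (s : Finset Ω)
    (hs : ∀ x ∈ s, x ∈ ⨆ n, E n) : ∀ᶠ n in Filter.atTop, ∀ x ∈ s, x ∈ E n := by
  rw [Filter.eventually_all_finset]
  intro x hx
  obtain ⟨n, hn⟩ := (mem_iSup_of_monotone hE).1 (hs x hx)
  exact Filter.eventually_atTop.2 ⟨n, fun m hm => hE hm hn⟩

theorem IntermediateField.eventually_exists_map_eq (hE : Monotone E)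
    (f : (⨆ n, E n : IntermediateField k Ω)[X]) :
    ∀ᶠ n in Filter.atTop, ∃ q : (E n)[X],
      q.map (algebraMap (E n) Ω) = f.map (algebraMap (⨆ n, E n : IntermediateField k Ω) Ω) := by
  classical
  filter_upwards [eventually_mem_of_finset hE
    (f.support.image fun j => ((f.coeff j : (⨆ n, E n : IntermediateField k Ω)) : Ω)) (by
      intro x hx
      obtain ⟨j, -, rfl⟩ := Finset.mem_image.1 hx
      exact (f.coeff j).2)] with n hn
  refine exists_map_eq fun j => ?_
  rw [coeff_map]
  by_cases hj : j ∈ f.support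
  · exact hn _ (Finset.mem_image.2 ⟨j, hj, rfl⟩)
  · rw [notMem_support_iff.1 hj, map_zero]
    exact zero_mem _

theorem IntermediateField.eventually_exists_map_map_eq (hE : Monotone E)
    (g : (⨆ n, E n : IntermediateField k Ω)[X][X]) :
    ∀ᶠ n in Filter.atTop, ∃ q : (E n)[X][X],
      q.map (mapRingHom (algebraMap (E n) Ω)) =
        g.map (mapRingHom (algebraMap (⨆ n, E n : IntermediateField k Ω) Ω)) := by
  have h : ∀ᶠ n in Filter.atTop, ∀ i ∈ g.support, ∃ q : (E n)[X], q.map (algebraMap (E n) Ω) =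
      (g.coeff i).map (algebraMap (⨆ n, E n : IntermediateField k Ω) Ω) := by
    rw [Filter.eventually_all_finset]
    exact fun i _ => eventually_exists_map_eq hE (g.coeff i)
  filter_upwards [h] with n hn
  refine exists_map_map_eq fun i j => ?_
  rw [coeff_map]
  by_cases hi : i ∈ g.support
  · obtain ⟨q, hq⟩ := hn i hi
    rw [coe_mapRingHom, ← hq, coeff_map]
    exact (q.coeff j).2
  · rw [notMem_support_iff.1 hi, map_zero, coeff_zero]
    exact zero_mem _

/-- A polynomial that is irreducible over all large fields of a chain is irreducible over the
union of the chain. -/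
theorem IntermediateField.irreducible_iSup (hE : Monotone E)
    {f : (⨆ n, E n : IntermediateField k Ω)[X]}
    (hf : ∀ᶠ n in Filter.atTop, ∃ q : (E n)[X], q.map (algebraMap (E n) Ω) =
      f.map (algebraMap (⨆ n, E n : IntermediateField k Ω) Ω) ∧ Irreducible q) :
    Irreducible f := by
  refine ⟨fun hu => ?_, fun a b hab => ?_⟩
  · obtain ⟨n, q, hq, hirr⟩ := hf.exists
    refine hirr.not_isUnit ((isUnit_map (algebraMap (E n) Ω)).1 ?_)
    rw [hq]
    exact (isUnit_map _).2 hu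
  -- Both factors have finitely many coefficients, so the factorization already takes place at a
  -- large stage.
  · obtain ⟨n, ⟨q, hq, hirr⟩, ⟨a₀, ha₀⟩, ⟨b₀, hb₀⟩⟩ := (hf.and
      ((eventually_exists_map_eq hE a).and (eventually_exists_map_eq hE b))).exists
    have hq' : q = a₀ * b₀ := by
      apply Polynomial.map_injective (algebraMap (E n) Ω) (algebraMap (E n) Ω).injective
      rw [hq, hab, Polynomial.map_mul, Polynomial.map_mul, ha₀, hb₀]
    rcases hirr.isUnit_or_isUnit hq' with h | h
    · refine Or.inl ((isUnit_map (algebraMap _ Ω)).1 (ha₀ ▸ (isUnit_map _).2 h))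
    · refine Or.inr ((isUnit_map (algebraMap _ Ω)).1 (hb₀ ▸ (isUnit_map _).2 h))

/-- A finite subextension has a primitive element, which lies in some `E n`; the degree of its
minimal polynomial divides the power of two `[E n : k]`. -/
theorem supernaturalDegree_iSup [CharZero k] (hE : Monotone E)
    (hdeg : ∀ n, ∃ m, Module.finrank k (E n) = 2 ^ m)
    {p : ℕ} (hp : p.Prime) (hp2 : p ≠ 2) :
    supernaturalDegree k (⨆ n, E n : IntermediateField k Ω) p = 0 := by
  rw [supernaturalDegree, ← bot_eq_zero, iSup₂_eq_bot]
  intro L hL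
  rw [bot_eq_zero, Nat.cast_eq_zero]
  obtain ⟨α, hα⟩ := Field.exists_primitive_element k L
  obtain ⟨n, hn⟩ := (IntermediateField.mem_iSup_of_monotone hE).1 α.1.2
  obtain ⟨m, hm⟩ := hdeg n
  have hfin : FiniteDimensional k (E n) :=
    -- `finrank` is 0 in infinite dimension, so a positive value proves finiteness.
    Module.finite_of_finrank_pos (by rw [hm]; positivity)
  have hint : IsIntegral k α := IsIntegral.of_finite k α
  have h1 : Module.finrank k L = (minpoly k (⟨α.1.1, hn⟩ : E n)).natDegree := by
    rw [← IntermediateField.finrank_top', ← hα, IntermediateField.adjoin.finrank hint,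
      ← minpoly.algebraMap_eq (B' := Ω) (algebraMap (E n) Ω).injective ⟨α.1.1, hn⟩,
      ← minpoly.algebraMap_eq (B' := (⨆ n, E n : IntermediateField k Ω))
        (algebraMap L _).injective α,
      ← minpoly.algebraMap_eq (B' := Ω)
        (algebraMap (⨆ n, E n : IntermediateField k Ω) Ω).injective]
    rfl
  have h2 : Module.finrank k L ∣ 2 ^ m := by
    rw [h1, ← hm]
    exact minpoly.degree_dvd (IsIntegral.of_finite k _)
  refine padicValNat.eq_zero_of_not_dvd fun hpL => hp2 ?_
  exact (Nat.prime_dvd_prime_iff_eq hp Nat.prime_two).1 (hp.dvd_of_dvd_pow (hpL.trans h2))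

end Union

/-! ### The union of the generic chain -/

/-- Over a countable Hilbertian field of characteristic zero there is a Hilbertian algebraic extension
of `2`-power degree all of whose arboreal representations have images of infinite index. -/
theorem exists_isHilbertian_not_finiteIndex_arborealRep (k : Type u) [Field k] [CharZero k]
    [Countable k] (hk : IsHilbertian k) :
    ∃ (F : Type u) (_ : Field F) (_ : Algebra k F),
      Algebra.IsAlgebraic k F ∧ IsHilbertian F ∧
      (∀ p : ℕ, p.Prime → p ≠ 2 → supernaturalDegree k F p = 0) ∧
      ∀ (f : F[X]) (hf : SeparableIterates f), 2 ≤ f.natDegree →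
        ¬ (arborealRep f hf).range.FiniteIndex := by
  obtain ⟨p, hmono, hsq, hspec⟩ := exists_generic_chain hk
  have hE : Monotone fun n => (p n).field := fun m n h => ApproxField.field_mono (hmono h)
  let F : IntermediateField k (AlgebraicClosure k) := ⨆ n, (p n).field
  have hle : ∀ n, (p n).field ≤ F := fun n => le_iSup (fun n => (p n).field) n
  refine ⟨F, inferInstance, inferInstance, inferInstance, ?_,
    fun q hq hq2 => supernaturalDegree_iSup hE (fun n => (p n).finrank_eq) hq hq2, ?_⟩
  · intro g hg hdeg hfin
    set G := g.map (mapRingHom (algebraMap F (AlgebraicClosure k))) with hG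
    -- Were the set of good values finite, it could serve as the excluded set `A`; the chain then
    -- provides a good value outside it.
    obtain ⟨n, a, ha, haA, hmem⟩ := hspec G
      ((hfin.image (algebraMap F (AlgebraicClosure k))).toFinset) (by
        filter_upwards [IntermediateField.eventually_exists_map_map_eq hE g] with n hn
        obtain ⟨g₀, hg₀⟩ := hn
        let φ : (p n).field →+* F := (IntermediateField.inclusion (hle n)).toRingHom
        have hmap : g₀.map (mapRingHom φ) = g := by
          apply map_injective (mapRingHom (algebraMap F (AlgebraicClosure k)))
            (map_injective _ (algebraMap F (AlgebraicClosure k)).injective)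
          rw [Polynomial.map_map, mapRingHom_comp]
          exact hg₀
        refine ⟨g₀, hg₀, Irreducible.of_map_map (φ := φ) (hmap ▸ hg), ?_⟩
        rwa [← hmap, natDegree_map_eq_of_injective (f := mapRingHom φ)
          (map_injective φ φ.injective)] at hdeg)
    refine haA ?_
    rw [Set.Finite.mem_toFinset]
    refine ⟨⟨a, hle n ha⟩, ?_, rfl⟩
    refine IntermediateField.irreducible_iSup hE ?_
    filter_upwards [Filter.eventually_ge_atTop n] with m hm
    have := (p m).irreducible _ (ApproxField.polys_mono (hmono hm) hmem)
    rw [hG] at this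
    obtain ⟨q, hq, hirr⟩ := this
    refine ⟨q, ?_, hirr⟩
    rw [hq]
    exact (map_evalRingHom_algebraMap g (⟨a, hle n ha⟩ : F)).symm
  · intro f hf hd
    refine not_finiteIndex_range_arborealRep f hf hd fun N => ?_
    have hdisc : ∀ n, ((f.map (algebraMap F (AlgebraicClosure k))).comp^[n] X).scaledDiscr =
        algebraMap F (AlgebraicClosure k) (f.comp^[n] X).scaledDiscr := fun n => by
      rw [← map_iterate_comp_X, scaledDiscr_map (algebraMap F (AlgebraicClosure k)).injective]
    obtain ⟨i, n, hn, h⟩ := hsq (f.map (algebraMap F (AlgebraicClosure k))) N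
      (IntermediateField.eventually_exists_map_eq hE f)
    have hsquare : ∀ (c : F) (t : AlgebraicClosure k), t ∈ (p i).field →
        t ^ 2 = algebraMap F (AlgebraicClosure k) c → IsSquare c := fun c t ht htc =>
      ⟨⟨t, hle i ht⟩, (algebraMap F (AlgebraicClosure k)).injective (by
        rw [← htc, map_mul, sq]; rfl)⟩
    simp only [hdisc, ← map_mul] at h
    refine ⟨n, hn, ?_⟩
    rcases h with ⟨t, ht, htc⟩ | ⟨m, hm, t, ht, htc⟩
    · exact Or.inl (hsquare _ t ht htc)
    · exact Or.inr ⟨m, hm, hsquare _ t ht htc⟩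

theorem theorem1p2 (k : Type u) [Field k] [CharZero k] [Countable k] (hk : IsHilbertian k) :
    (∃ (F : Type u) (_ : Field F) (_ : Algebra k F),
      Algebra.IsAlgebraic k F ∧ IsHilbertian F ∧
      (∀ p : ℕ, p.Prime → p ≠ 2 → supernaturalDegree k F p = 0) ∧
      ∀ (f : F[X]) (hf : SeparableIterates f), 2 ≤ f.natDegree →
        ¬ (arborealRep f hf).range.FiniteIndex) ∧
    ¬ OdoniConjecture.{u} := by
  have h := exists_isHilbertian_not_finiteIndex_arborealRep k hk
  refine ⟨h, fun hO => ?_⟩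
  obtain ⟨F, _, _, -, hF, -, hindex⟩ := h
  have : CharZero F := charZero_of_injective_algebraMap (algebraMap k F).injective
  -- Degree 2 suffices: a surjective representation has image of index one.
  obtain ⟨f, hf, hdeg, hsurj⟩ := hO F hF 2 one_lt_two
  refine hindex f hf hdeg.ge ?_
  rw [MonoidHom.range_eq_top.2 hsurj]
  infer_instance
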